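/- **Conventions.** All structures and trees are finite. Let $\Sigma$ be a finite relational signature. *Incidence structures.* For a $\Sigma$-structure $\mathfrak A$ with domain $A$, let $E$ be the set of all tuples belonging to at least one relation of $\mathfrak A$, and let $r$ be the maximal arity of a symbol in $\Sigma$. The incidence structure is $\mathfrak A_{\mathrm{in}}=\langle A\mathbin{\dot\cup}E,(P_R)_{R\in\Sigma},\mathrm{in}_0,\dots,\mathrm{in}_{r-1}\rangle$, where $P_R=\{\bar c\in E: \bar c\in R^{\mathfrak A}\}$ and $\mathrm{in}_i=\{(a,\bar c)\in A\times E: |\bar c|>i,\ a=c_i\}$. *Trees.* An $m$-coloured order-tree is a structure $\mathfrak T=\langle T,\preceq,P_0,\dots,P_{m-1}\rangle$ where $T$ is a finite (possibly empty) prefix-closed set of finite sequences over some set $D$, $\preceq$ is the prefix relation and $P_0,\dots,P_{m-1}\subseteq T$ are arbitrary. *Transductions.* A basic MSO-transduction is given by a list of monadic second-order formulae $\langle\chi,\delta(x),(\varphi_R(\bar x))_R\rangle$; it is defined on the structures $\mathfrak M\models\chi$, which it maps to the structure with domain $\{a:\mathfrak M\models\delta(a)\}$ and relations $R=\{\bar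 a:\mathfrak M\models\varphi_R(\bar a)\}$ on that domain. An MSO-transduction is a many-valued partial operation $\tau=\tau_0\circ\mathrm{copy}_l\circ\mathrm{exp}_p$ with $l\ge 1$, $p\ge 0$ and $\tau_0$ a basic MSO-transduction, where $\mathrm{exp}_p$ maps a structure to all its expansions by $p$ unary predicates, and $\mathrm{copy}_l$ maps a structure $\mathfrak M$ to itself if $l=1$ and, if $l\ge 2$, to the disjoint union of $l$ copies of $\mathfrak M$ expanded by unary predicates for the copies and by the relation that holds between any two copies of the same element. We write $\mathfrak B\in\tau(\mathfrak M)$ if $\mathfrak B$ is, up to isomorphism, one of the values of $\tau$ at $\mathfrak M$. *Tree decompositions.* A tree decomposition of $\mathfrak A$ with underlying tree $\mathfrak T$ is a family $(U_v)_{v\in T}$ of (possibly empty) sets $U_v\subseteq A$ such that for every $a\in A$ the set $\{v\in T:a\in U_v\}$ is nonempty and connected in the tree (whose edges link each vertex to its immediate successors), and every tuple of every relation of $\mathfrak A$ has all its components in some $U_v$. Its width is $\sup_{v\in T}(|U_v|-1)$. **Theorem.** Let $m\in\mathbb N$, and let $\tau$ be an MSO-transduction from the signature of $m$-coloured order-trees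 to the signature of incidence structures of $\Sigma$-structures. Then there exists $k\in\mathbb N$ such that, for every $m$-coloured order-tree $\mathfrak T$ and every $\Sigma$-structure $\mathfrak A$ with $\mathfrak A_{\mathrm{in}}\in\tau(\mathfrak T)$, the structure $\mathfrak A$ has a tree decomposition of width at most $k$ whose underlying tree is $\mathfrak T$. (In particular, this applies to every $\tau$ all of whose values on $m$-coloured order-trees are incidence structures.) -/

import Mathlib

open FirstOrder FirstOrder.Language

universe u v u' v' w w'

namespace MSO

/-! ### Monadic second-order logic -/

/-- Monadic second-order formulae over the relation symbols of `L`, in the variant that has only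
set variables. A formula in `Formula L n` has free set variables indexed by `Fin n`; the atomic
formulae are `X ⊆ Y` and `R Z₀ … Zₗ₋₁`. The quantifier `ex` binds the variable `Fin.last n`. -/
inductive Formula (L : FirstOrder.Language.{u, v}) : ℕ → Type v
  | verum {n : ℕ} : Formula L n
  | subset {n : ℕ} (X Y : Fin n) : Formula L n
  | rel {n l : ℕ} (R : L.Relations l) (Z : Fin l → Fin n) : Formula L n
  | neg {n : ℕ} (φ : Formula L n) : Formula L n
  | and {n : ℕ} (φ ψ : Formula L n) : Formula L n
  | ex {n : ℕ} (φ : Formula L (n + 1)) : Formula L n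

/-- Satisfaction. An atom `R Z₀ … Zₗ₋₁` says that there are elements `aᵢ ∈ Zᵢ` such that the
tuple `(a₀, …, aₗ₋₁)` is in `R`. -/
def Formula.Realize {L : FirstOrder.Language.{u, v}} {M : Type w} [L.Structure M] :
    {n : ℕ} → Formula L n → (Fin n → Set M) → Prop
  | _, .verum, _ => True
  | _, .subset X Y, V => V X ⊆ V Y
  | _, .rel R Z, V => ∃ a, (∀ i, a i ∈ V (Z i)) ∧ Structure.RelMap R a
  | _, .neg φ, V => ¬ φ.Realize V
  | _, .and φ ψ, V => φ.Realize V ∧ ψ.Realize V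
  | _, .ex φ, V => ∃ X : Set M, φ.Realize (Fin.snoc V X)

/-- Satisfaction of a formula with first-order arguments: elements are singleton sets. -/
def Formula.RealizeAt {L : FirstOrder.Language.{u, v}} {M : Type w} [L.Structure M] {n : ℕ}
    (φ : Formula L n) (a : Fin n → M) : Prop :=
  φ.Realize fun i => {a i}

/-! ### Transductions -/

/-- Symbols for `p` unary predicates. -/
inductive ParamRel (p : ℕ) : ℕ → Type
  | param (i : Fin p) : ParamRel p 1

/-- The signature consisting of `p` unary predicates. -/
def paramLanguage (p : ℕ) : FirstOrder.Language.{0, 0} := ⟨fun _ => Empty, ParamRel p⟩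

instance (p : ℕ) : (paramLanguage p).IsRelational := fun _ => inferInstanceAs (IsEmpty Empty)

/-- The domain of the expansion of `M` by the unary predicates `Q₀, …, Qₚ₋₁`. -/
def Expansion {M : Type w} {p : ℕ} (_ : Fin p → Set M) : Type w := M

instance {L : FirstOrder.Language.{u, v}} {M : Type w} [S : L.Structure M] {p : ℕ} (Q : Fin p → Set M) :
    L.Structure (Expansion Q) := S

instance {M : Type w} {p : ℕ} (Q : Fin p → Set M) :
    (paramLanguage p).Structure (Expansion Q) where
  funMap f := f.elim
  RelMap
    | .param i, x => Q i (x 0)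

/-- The relation symbols added by `copy_k`. If `k = 1`, then there are none. -/
inductive CopyRel (k : ℕ) : ℕ → Type
  | copy (hk : 2 ≤ k) (i : Fin k) : CopyRel k 1
  | sim (hk : 2 ≤ k) : CopyRel k 2

/-- The signature consisting of the relation symbols added by `copy_k`. -/
def copyLanguage (k : ℕ) : FirstOrder.Language.{0, 0} := ⟨fun _ => Empty, CopyRel k⟩

instance (k : ℕ) : (copyLanguage k).IsRelational := fun _ => inferInstanceAs (IsEmpty Empty)

/-- The domain of the disjoint union of `k` copies of `M`. -/
def Copies (k : ℕ) (M : Type w) : Type w := M × Fin k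

/-- The disjoint union of `k` copies of a relational structure. -/
instance {L : FirstOrder.Language.{u, v}} [L.IsRelational] {M : Type w} [L.Structure M] (k : ℕ) :
    L.Structure (Copies k M) where
  funMap f := isEmptyElim f
  RelMap R x := ∃ (i : Fin k) (a : _ → M), Structure.RelMap R a ∧ ∀ j, x j = (a j, i)

instance {M : Type w} (k : ℕ) : (copyLanguage k).Structure (Copies k M) where
  funMap f := f.elim
  RelMap
    | .copy _ i, x => (x 0).2 = i
    | .sim _, x => (x 0).1 = (x 1).1

/-- The definition scheme `⟨χ, δ(x), (φ_R(x₀, …, xₗ₋₁))_R⟩` of a basic transduction from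
`L`-structures to `L'`-structures. -/
structure BasicTransduction (L : FirstOrder.Language.{u, v}) (L' : FirstOrder.Language.{u', v'}) where
  χ : Formula L 0
  δ : Formula L 1
  φ : {l : ℕ} → L'.Relations l → Formula L l

/-- The domain of the structure produced by a basic transduction. -/
def BasicTransduction.Image {L : FirstOrder.Language.{u, v}} {L' : FirstOrder.Language.{u', v'}}
    (τ : BasicTransduction L L') (M : Type w) [L.Structure M] : Type w :=
  {a : M // τ.δ.RealizeAt fun _ => a}

instance {L : FirstOrder.Language.{u, v}} {L' : FirstOrder.Language.{u', v'}} [L'.IsRelational]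
    (τ : BasicTransduction L L') (M : Type w) [L.Structure M] : L'.Structure (τ.Image M) where
  funMap f := isEmptyElim f
  RelMap R x := (τ.φ R).RealizeAt fun i => (x i).1

/-- A transduction `τ₀ ∘ copy_k ∘ exp_p`, where `k ≥ 1` and `τ₀` is a basic transduction. -/
structure Transduction (L : FirstOrder.Language.{u, v}) (L' : FirstOrder.Language.{u', v'}) where
  k : ℕ
  one_le_k : 1 ≤ k
  p : ℕ
  basic : BasicTransduction ((L.sum (paramLanguage p)).sum (copyLanguage k)) L'

/-- `N ∈ τ(M)`: for some choice `Q` of the parameters, the structure `copy_k(M, Q)` satisfies `χ`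
and the structure that the basic transduction produces from it is (isomorphic to) `N`. -/
def Transduction.Produces {L : FirstOrder.Language.{u, v}} {L' : FirstOrder.Language.{u', v'}} [L.IsRelational]
    [L'.IsRelational] (τ : Transduction L L') (M : Type w) [L.Structure M] (N : Type w')
    [L'.Structure N] : Prop :=
  ∃ Q : Fin τ.p → Set M,
    τ.basic.χ.RealizeAt (M := Copies τ.k (Expansion Q)) Fin.elim0 ∧
      Nonempty (N ≃[L'] τ.basic.Image (Copies τ.k (Expansion Q)))

/-! ### Order-trees -/

/-- A finite tree domain over `D`, i.e., a finite prefix-closed (possibly empty) set of finite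
sequences, together with `m` arbitrary sets of vertices. -/
structure ColouredTree (D : Type w) (m : ℕ) where
  carrier : Set (List D)
  finite_carrier : carrier.Finite
  prefix_closed : ∀ x ∈ carrier, ∀ y, y <+: x → y ∈ carrier
  colour : Fin m → Set (List D)
  colour_subset : ∀ i, colour i ⊆ carrier

/-- The set of vertices of a tree, as a type. -/
def ColouredTree.Vertex {D : Type w} {m : ℕ} (T : ColouredTree D m) : Type w :=
  {x : List D // x ∈ T.carrier}

/-- The relation symbols of `m`-coloured order-trees. -/
inductive TreeRel (m : ℕ) : ℕ → Type
  | le : TreeRel m 2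
  | colour (i : Fin m) : TreeRel m 1

/-- The signature of `m`-coloured order-trees. -/
def treeLanguage (m : ℕ) : FirstOrder.Language.{0, 0} := ⟨fun _ => Empty, TreeRel m⟩

instance (m : ℕ) : (treeLanguage m).IsRelational := fun _ => inferInstanceAs (IsEmpty Empty)

/-- A tree as the structure `⟨T, ≼, P₀, …, Pₘ₋₁⟩`, where `≼` is the prefix relation. -/
instance {D : Type w} {m : ℕ} (T : ColouredTree D m) : (treeLanguage m).Structure T.Vertex where
  funMap f := f.elim
  RelMap
    | .le, x => (x 0).1 <+: (x 1).1
    | .colour i, x => (x 0).1 ∈ T.colour i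

/-- The undirected graph underlying the tree: vertices are adjacent to their successors. -/
def ColouredTree.graph {D : Type w} {m : ℕ} (T : ColouredTree D m) : SimpleGraph T.Vertex where
  Adj x y := (∃ d, y.1 = x.1 ++ [d]) ∨ ∃ d, x.1 = y.1 ++ [d]
  symm := ⟨fun _ _ h => h.symm⟩
  loopless := ⟨fun x h => by rcases h with ⟨d, h⟩ | ⟨d, h⟩ <;> simp at h⟩

/-! ### Incidence structures -/

/-- The relation symbols of incidence structures: `P_R`, for every relation symbol `R` of `L`, and
`inᵢ`, for every `i` less than the maximal arity of a relation symbol of `L`. -/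
inductive IncidenceRel (L : FirstOrder.Language.{u, v}) : ℕ → Type v
  | mem {l : ℕ} (R : L.Relations l) : IncidenceRel L 1
  | inc (i : ℕ) (hi : ∃ l, i < l ∧ Nonempty (L.Relations l)) : IncidenceRel L 2

/-- The signature of incidence structures of `L`-structures. -/
def incidenceLanguage (L : FirstOrder.Language.{u, v}) : FirstOrder.Language.{0, v} := ⟨fun _ => Empty, IncidenceRel L⟩

instance (L : FirstOrder.Language.{u, v}) : (incidenceLanguage L).IsRelational :=
  fun _ => inferInstanceAs (IsEmpty Empty)

/-- The set `E` of all tuples that belong to at least one relation of `A`. -/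
def Tuples (L : FirstOrder.Language.{u, v}) (A : Type w) [L.Structure A] : Type w :=
  {c : (l : ℕ) × (Fin l → A) // ∃ R : L.Relations c.1, Structure.RelMap R c.2}

/-- The domain `A ⊍ E` of the incidence structure of `A`. -/
def Incidence (L : FirstOrder.Language.{u, v}) (A : Type w) [L.Structure A] : Type w :=
  A ⊕ Tuples L A

/-- The incidence structure of `A`. -/
instance (L : FirstOrder.Language.{u, v}) (A : Type w) [L.Structure A] :
    (incidenceLanguage L).Structure (Incidence L A) where
  funMap f := f.elim
  RelMap
    | .mem (l := l) R, x => ∃ e : Tuples L A, x 0 = Sum.inr e ∧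
        ∃ c : Fin l → A, e.1 = ⟨l, c⟩ ∧ Structure.RelMap R c
    | .inc i _, x => ∃ (a : A) (e : Tuples L A), x 0 = Sum.inl a ∧ x 1 = Sum.inr e ∧
        ∃ h : i < e.1.1, a = e.1.2 ⟨i, h⟩

/-! ### Tree decompositions -/

/-- A tree decomposition of the `L`-structure `A` with underlying tree `T`.
(`SimpleGraph.Connected` includes nonemptiness.) -/
structure TreeDecomposition (L : FirstOrder.Language.{u, v}) (A : Type w) [L.Structure A] {D : Type w'}
    {m : ℕ} (T : ColouredTree D m) where
  U : T.Vertex → Set A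
  connected : ∀ a : A, (T.graph.induce {x | a ∈ U x}).Connected
  covers : ∀ {l : ℕ} (R : L.Relations l) (c : Fin l → A), Structure.RelMap R c →
    ∃ x, ∀ i, c i ∈ U x

/-- The width `sup_x (|U_x| - 1)` of the tree decomposition is at most `k`. -/
def TreeDecomposition.WidthLE {L : FirstOrder.Language.{u, v}} {A : Type w} [L.Structure A] {D : Type w'}
    {m : ℕ} {T : ColouredTree D m} (H : TreeDecomposition L A T) (k : ℕ) : Prop :=
  ∀ x, (H.U x).encard ≤ k + 1

end MSO

/-! Place every element and every tuple of `A` at the vertex of the tree that carries its image in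
the transduction. The bag of `v` contains the elements placed at `v`, and those `a` for which some
tuple containing `a` lies in another direction from `v` than `a` does. These bags form a tree
decomposition; the point is their size. At most `τ.k` elements sit at `v`. For the others, choose
for each `a` a tuple in a different direction. A random set `C` of directions separates each such
pair, in the given order, with probability at least 1/4, so some `C` separates a quarter of them
(`card_le_of_separated`). Across the cut given by `C`, prefix comparisons factor through `v`, so by
a composition argument each MSO formula has boundedly many rows, uniformly in all trees and cuts
(`finiteRows_cut`). But `inᵢ` is functional: a tuple has only one `i`-th component. Hence separated
elements with the same position and the same row coincide, which bounds their number. -/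

namespace MSO

/-! ### Formulae have finitely many rows with respect to a bipartition of the domain -/

section Rows

variable {L : FirstOrder.Language.{u, v}} {ι : Type w'} {M : ι → Type w} [∀ i, L.Structure (M i)]

/-- Truth of `φ` at `V` depends on the part of `V` inside `S i` only through one of finitely many
values, uniformly in `i`. -/
def FiniteRows (S : ∀ i, Set (M i)) {n : ℕ} (φ : Formula L n) : Prop :=
  ∃ α : Type, Finite α ∧ ∀ i, ∃ t : (Fin n → Set (M i)) → α, ∀ V V', t V = t V' →
    ∀ Y : Fin n → Set (M i),
      φ.Realize (fun j => (S i).ite (V j) (Y j)) → φ.Realize fun j => (S i).ite (V' j) (Y j)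

theorem mem_ite_iff {X : Type*} {S V Y : Set X} {x : X} :
    x ∈ S.ite V Y ↔ (x ∈ S ∧ x ∈ V) ∨ (x ∉ S ∧ x ∈ Y) := by
  simp only [Set.ite, Set.mem_union, Set.mem_inter_iff, Set.mem_sdiff]; tauto

theorem snoc_ite {X : Type*} (S : Set X) {n : ℕ} (V Y : Fin n → Set X) (A B : Set X) :
    (Fin.snoc (fun j => S.ite (V j) (Y j)) (S.ite A B) : Fin (n + 1) → Set X) =
      fun j => S.ite ((Fin.snoc V A : Fin (n + 1) → Set X) j)
        ((Fin.snoc Y B : Fin (n + 1) → Set X) j) := by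
  funext j
  refine Fin.lastCases ?_ (fun j => ?_) j <;> simp

theorem FiniteRows.unary (S : ∀ i, Set (M i)) {n : ℕ} (R : L.Relations 1) (Z : Fin 1 → Fin n) :
    FiniteRows S (Formula.rel R Z) := by
  refine ⟨Prop, inferInstance, fun i =>
    ⟨fun V => ∃ a : Fin 1 → M i, (a 0 ∈ S i ∧ a 0 ∈ V (Z 0)) ∧ Structure.RelMap R a, ?_⟩⟩
  rintro V V' h Y ⟨a, ha, hR⟩
  rcases mem_ite_iff.1 (ha 0) with h0 | h0
  · obtain ⟨b, hb, hR'⟩ := (iff_of_eq h).1 ⟨a, h0, hR⟩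
    exact ⟨b, fun j => by rw [Subsingleton.elim j 0]; exact mem_ite_iff.2 (.inl hb), hR'⟩
  · exact ⟨a, fun j => by rw [Subsingleton.elim j 0]; exact mem_ite_iff.2 (.inr h0), hR⟩

/-- A binary relation has finitely many rows if it is a finite union of rectangles on the pairs
that are separated by the bipartition. -/
theorem FiniteRows.binary (S : ∀ i, Set (M i)) {n : ℕ} (R : L.Relations 2) (Z : Fin 2 → Fin n)
    {β : Type} [Finite β] (P P' : ∀ i, β → M i → Prop)
    (hP : ∀ i (a : Fin 2 → M i), ¬ (a 0 ∈ S i ↔ a 1 ∈ S i) →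
      (Structure.RelMap R a ↔ ∃ b, P i b (a 0) ∧ P' i b (a 1))) :
    FiniteRows S (Formula.rel R Z) := by
  -- The row records whether the atom is witnessed inside `S`, and which rectangles are met from
  -- inside by each of the two arguments.
  refine ⟨Prop × Set β × Set β, inferInstance, fun i =>
    ⟨fun V => ⟨∃ a : Fin 2 → M i, (∀ j, a j ∈ S i ∧ a j ∈ V (Z j)) ∧ Structure.RelMap R a,
      {b | ∃ x, (x ∈ S i ∧ x ∈ V (Z 0)) ∧ P i b x},
      {b | ∃ x, (x ∈ S i ∧ x ∈ V (Z 1)) ∧ P' i b x}⟩, ?_⟩⟩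
  rintro V V' h Y ⟨a, ha, hR⟩
  simp only [Prod.mk.injEq] at h
  obtain ⟨h1, h2, h3⟩ := h
  rcases mem_ite_iff.1 (ha 0) with h0 | h0 <;> rcases mem_ite_iff.1 (ha 1) with h0' | h0'
  · obtain ⟨b, hb, hR'⟩ := (iff_of_eq h1).1 ⟨a, Fin.forall_fin_two.2 ⟨h0, h0'⟩, hR⟩
    exact ⟨b, fun j => mem_ite_iff.2 (.inl (hb j)), hR'⟩
  · obtain ⟨b, hb, hb'⟩ := (hP i a (by tauto)).1 hR
    obtain ⟨x, hx, hxb⟩ := h2.subset (show b ∈ _ from ⟨a 0, h0, hb⟩)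
    refine ⟨![x, a 1], Fin.forall_fin_two.2 ⟨mem_ite_iff.2 (.inl hx),
      mem_ite_iff.2 (.inr h0')⟩, (hP i _ ?_).2 ⟨b, hxb, hb'⟩⟩
    simp only [Matrix.cons_val_zero, Matrix.cons_val_one]; tauto
  · obtain ⟨b, hb, hb'⟩ := (hP i a (by tauto)).1 hR
    obtain ⟨x, hx, hxb⟩ := h3.subset (show b ∈ _ from ⟨a 1, h0', hb'⟩)
    refine ⟨![a 0, x], Fin.forall_fin_two.2 ⟨mem_ite_iff.2 (.inr h0),
      mem_ite_iff.2 (.inl hx)⟩, (hP i _ ?_).2 ⟨b, hb, hxb⟩⟩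
    simp only [Matrix.cons_val_zero, Matrix.cons_val_one]; tauto
  · exact ⟨a, Fin.forall_fin_two.2 ⟨mem_ite_iff.2 (.inr h0), mem_ite_iff.2 (.inr h0')⟩, hR⟩

/-- Composition method: the finite set of values grows along the formula, with a power set at each
quantifier, and never depends on the index `i`. -/
theorem FiniteRows.of_rel (S : ∀ i, Set (M i))
    (hrel : ∀ {n l : ℕ} (R : L.Relations l) (Z : Fin l → Fin n), FiniteRows S (Formula.rel R Z))
    {n : ℕ} (φ : Formula L n) : FiniteRows S φ := by
  induction φ with
  | verum => exact ⟨Unit, inferInstance, fun _ => ⟨fun _ => (), fun _ _ _ _ _ => trivial⟩⟩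
  | subset X Y =>
    refine ⟨Prop, inferInstance, fun i => ⟨fun V => ∀ x ∈ S i, x ∈ V X → x ∈ V Y, ?_⟩⟩
    intro V V' h W hW x hx
    rcases mem_ite_iff.1 hx with hx | hx
    · refine mem_ite_iff.2 (.inl ⟨hx.1, (iff_of_eq h).1 (fun y hy hyX => ?_) x hx.1 hx.2⟩)
      have := mem_ite_iff.1 (hW (mem_ite_iff.2 (.inl ⟨hy, hyX⟩)))
      tauto
    · have := mem_ite_iff.1 (hW (mem_ite_iff.2 (.inr hx)))
      exact mem_ite_iff.2 (.inr ⟨hx.1, by tauto⟩)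
  | rel R Z => exact hrel R Z
  | neg φ ih =>
    obtain ⟨α, hα, h⟩ := ih
    refine ⟨α, hα, fun i => ?_⟩
    obtain ⟨t, ht⟩ := h i
    exact ⟨t, fun V V' hV Y hn hp => hn (ht V' V hV.symm Y hp)⟩
  | and φ ψ ih₁ ih₂ =>
    obtain ⟨α, hα, h₁⟩ := ih₁
    obtain ⟨β, hβ, h₂⟩ := ih₂
    refine ⟨α × β, inferInstance, fun i => ?_⟩
    obtain ⟨t, ht⟩ := h₁ i
    obtain ⟨s, hs⟩ := h₂ i
    exact ⟨fun V => (t V, s V), fun V V' hV Y hr =>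
      ⟨ht V V' (Prod.ext_iff.1 hV).1 Y hr.1, hs V V' (Prod.ext_iff.1 hV).2 Y hr.2⟩⟩
  | ex φ ih =>
    obtain ⟨α, hα, h⟩ := ih
    refine ⟨Set α, inferInstance, fun i => ?_⟩
    obtain ⟨t, ht⟩ := h i
    refine ⟨fun V => Set.range fun X : Set (M i) => t (Fin.snoc V X), ?_⟩
    rintro V V' hV Y ⟨X, hX⟩
    obtain ⟨X', hX'⟩ := hV.subset (Set.mem_range_self X)
    -- Only the inner part of the witness is exchanged, for one with the same value; the outer part
    -- stays.
    refine ⟨(S i).ite X' X, ?_⟩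
    rw [← Set.ite_same (S i) X, snoc_ite] at hX
    rw [snoc_ite]
    exact ht _ _ hX'.symm _ hX

end Rows

/-! ### Directions at a vertex of a tree -/

section Direction

variable {D : Type w}

open Classical in
/-- The direction in which `x` lies, seen from `v`: either `v` itself, or a successor of `v`, or
`none` if `x` is not below `v`. -/
noncomputable def direction (v x : List D) : Option (List D) :=
  if v <+: x then some (x.take (v.length + 1)) else none

theorem direction_of_prefix {v x : List D} (h : v <+: x) :
    direction v x = some (x.take (v.length + 1)) := if_pos h

theorem direction_of_not_prefix {v x : List D} (h : ¬ v <+: x) : direction v x = none := if_neg h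

/-- A path joining different directions at `v` passes through `v`. The right-hand side is a
rectangle, as `FiniteRows.binary` requires. -/
theorem prefix_iff_of_direction_ne {v x y : List D} (h : direction v x ≠ direction v y) :
    x <+: y ↔ x <+: v ∧ v <+: y := by
  refine ⟨fun hxy => ?_, fun hh => hh.1.trans hh.2⟩
  by_cases hx : v <+: x
  · refine ⟨?_, hx.trans hxy⟩
    by_cases hl : v.length + 1 ≤ x.length
    · refine (h ?_).elim
      rw [direction_of_prefix hx, direction_of_prefix (hx.trans hxy)]
      obtain ⟨z, rfl⟩ := hxy
      rw [List.take_append_of_le_length hl]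
    · rw [hx.eq_of_length (le_antisymm hx.length_le (by omega))]
  · by_cases hy : v <+: y
    · exact ⟨(List.prefix_or_prefix_of_prefix hxy hy).resolve_right hx, hy⟩
    · exact (h (by rw [direction_of_not_prefix hx, direction_of_not_prefix hy])).elim

theorem eq_of_direction_eq_self {v x : List D} (h : direction v x = direction v v) : x = v := by
  rw [direction_of_prefix List.prefix_rfl] at h
  by_cases hx : v <+: x
  · rw [direction_of_prefix hx] at h
    have h' := congrArg List.length (Option.some_injective _ h)
    simp only [List.length_take] at h'
    exact (hx.eq_of_length (by omega)).symm
  · rw [direction_of_not_prefix hx] at h; cases h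

theorem direction_append_singleton {v x : List D} {d : D} :
    direction v x = some (v ++ [d]) ↔ v ++ [d] <+: x := by
  constructor
  · intro h
    by_cases hx : v <+: x
    · rw [direction_of_prefix hx] at h
      rw [← Option.some_injective _ h]; exact List.take_prefix _ _
    · rw [direction_of_not_prefix hx] at h; cases h
  · rintro ⟨z, rfl⟩
    rw [direction_of_prefix (by simp [List.append_assoc])]
    simp [List.take_append]

end Direction

/-! ### Formulae over copies of coloured trees -/

/-- A choice of a tree with parameters, a vertex, and a set of directions at this vertex. -/
structure Cut (m p : ℕ) where
  D : Type w
  T : ColouredTree D m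
  Q : Fin p → Set T.Vertex
  v : T.Vertex
  C : Set (Option (List D))

/-- The elements whose direction belongs to the chosen set. -/
def Cut.side {m p : ℕ} (k : ℕ) (K : Cut.{w} m p) : Set (Copies k (Expansion K.Q)) :=
  {x | direction K.v.1 (Subtype.val (p := (· ∈ K.T.carrier)) x.1) ∈ K.C}

/-- Indexing by all cuts makes the number of rows uniform. Across a cut, `≼` is a union of one
rectangle per copy, while copies of one vertex share a direction and so are never separated. -/
theorem finiteRows_cut {m p k n : ℕ}
    (φ : Formula (((treeLanguage m).sum (paramLanguage p)).sum (copyLanguage k)) n) :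
    FiniteRows (fun K : Cut.{w} m p => K.side k) φ := by
  refine FiniteRows.of_rel _ (fun {n l} R Z => ?_) φ
  rcases R with (R | R) | R
  · cases R with
    | le =>
      refine FiniteRows.binary (β := Fin k) _ _ Z
        (fun K b x => x.2 = b ∧ Subtype.val (p := (· ∈ K.T.carrier)) x.1 <+: K.v.1)
        (fun K b x => x.2 = b ∧ K.v.1 <+: Subtype.val (p := (· ∈ K.T.carrier)) x.1) ?_
      intro K a ha
      have hd : direction K.v.1 (Subtype.val (p := (· ∈ K.T.carrier)) (a 0).1) ≠
          direction K.v.1 (Subtype.val (p := (· ∈ K.T.carrier)) (a 1).1) := by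
        intro h
        apply ha
        simp only [Cut.side, Set.mem_ofPred_eq, h]
      have hp := prefix_iff_of_direction_ne hd
      constructor
      · rintro ⟨i, b, hb, hab⟩
        have hb' : Subtype.val (p := (· ∈ K.T.carrier)) (b 0) <+:
          Subtype.val (p := (· ∈ K.T.carrier)) (b 1) := hb
        refine ⟨i, ?_⟩
        rw [hab 0, hab 1] at hp ⊢
        exact ⟨⟨rfl, (hp.1 hb').1⟩, rfl, (hp.1 hb').2⟩
      · rintro ⟨i, ⟨h0, h0'⟩, h1, h1'⟩
        refine ⟨i, fun j => (a j).1, hp.2 ⟨h0', h1'⟩, Fin.forall_fin_two.2 ⟨?_, ?_⟩⟩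
        · rw [← h0]; rfl
        · rw [← h1]; rfl
    | colour i => exact FiniteRows.unary _ _ Z
  · cases R; exact FiniteRows.unary _ _ Z
  · cases R with
    | copy hk i => exact FiniteRows.unary _ _ Z
    | sim hk =>
      refine FiniteRows.binary (β := Empty) _ _ Z (fun _ _ _ => False) (fun _ _ _ => False) ?_
      intro K a ha
      refine ⟨fun h => (ha ?_).elim, fun ⟨b, _⟩ => b.elim⟩
      have h' : (a 0).1 = (a 1).1 := h
      simp only [Cut.side, Set.mem_ofPred_eq, h']

end MSO

namespace MSO

/-! ### Separating many pairs by a single set -/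

open Classical in
-- Forcing `d` into `C` and `e` out of it forgets just two bits.
theorem two_pow_le_card_separating {α : Type*} [Fintype α] {d e : α} (h : d ≠ e) :
    2 ^ Fintype.card α ≤
      4 * (Finset.univ.filter fun C : Finset α => d ∈ C ∧ e ∉ C).card := by
  have key : (Finset.univ : Finset (Finset α)).card ≤
      ((Finset.univ.filter fun C : Finset α => d ∈ C ∧ e ∉ C) ×ˢ
        (Finset.univ : Finset (Bool × Bool))).card := by
    refine Finset.card_le_card_of_injOn
      (fun C => ((insert d C).erase e, (decide (d ∈ C), decide (e ∈ C)))) ?_ ?_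
    · intro C _
      simp [h]
    · intro C _ C' _ hC
      simp only [Prod.mk.injEq, decide_eq_decide] at hC
      obtain ⟨h1, h2, h3⟩ := hC
      ext x
      by_cases hx : x = d
      · rw [hx, h2]
      by_cases hx' : x = e
      · rw [hx', h3]
      have := congrArg (x ∈ ·) h1
      simpa [hx, hx'] using this
  simp only [Finset.card_product, Finset.card_univ, Fintype.card_finset, Fintype.card_prod,
    Fintype.card_bool] at key
  linarith

open Classical in
/-- Some set separates a quarter of the given pairs. -/
theorem card_le_of_separated {α A : Type*} [Finite α] (B : Finset A) (d e : A → α)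
    (hde : ∀ a ∈ B, d a ≠ e a) (N : ℕ)
    (hN : ∀ (C : Finset α) (F : Finset A), (∀ a ∈ F, a ∈ B ∧ d a ∈ C ∧ e a ∉ C) → F.card ≤ N) :
    B.card ≤ 4 * N := by
  have := Fintype.ofFinite α
  -- Double counting of pairs `(a, C)` with `C` separating `d a` from `e a`.
  have h1 : B.card * 2 ^ Fintype.card α ≤
      ∑ a ∈ B, 4 * (Finset.univ.filter fun C : Finset α => d a ∈ C ∧ e a ∉ C).card := by
    rw [← smul_eq_mul]
    exact Finset.card_nsmul_le_sum _ _ _ fun a ha => two_pow_le_card_separating (hde a ha)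
  have h2 : ∑ a ∈ B, (Finset.univ.filter fun C : Finset α => d a ∈ C ∧ e a ∉ C).card =
      ∑ C : Finset α, (B.filter fun a => d a ∈ C ∧ e a ∉ C).card :=
    Finset.sum_card_bipartiteAbove_eq_sum_card_bipartiteBelow
      (fun a (C : Finset α) => d a ∈ C ∧ e a ∉ C)
  have h3 : ∑ C : Finset α, (B.filter fun a => d a ∈ C ∧ e a ∉ C).card ≤
      2 ^ Fintype.card α * N := by
    refine (Finset.sum_le_card_nsmul _ _ N fun C _ =>
      hN C _ fun a ha => Finset.mem_filter.1 ha).trans ?_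
    simp [Fintype.card_finset]
  rw [← Finset.mul_sum, h2] at h1
  refine Nat.le_of_mul_le_mul_right (c := 2 ^ Fintype.card α) ?_ (by positivity)
  nlinarith

/-! ### Tree decompositions from placements in a tree -/

section Placement

variable {D : Type w} {m : ℕ} (T : ColouredTree D m)

/-- The vertices on the paths from `x` to the vertices in `Y` induce a connected graph. -/
theorem connected_induce_between (x : T.Vertex) (Y : Set T.Vertex) :
    (T.graph.induce
      {v | x = v ∨ ∃ y ∈ Y, direction v.1 x.1 ≠ direction v.1 y.1}).Connected := by
  set W : Set T.Vertex := {v | x = v ∨ ∃ y ∈ Y, direction v.1 x.1 ≠ direction v.1 y.1} with hW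
  have hxW : x ∈ W := .inl rfl
  -- From an ancestor of `x`, descend towards `x`: the next vertex has `x` below it, but not `y`.
  have below : ∀ (n : ℕ) (v : T.Vertex) (hv : v ∈ W), v.1 <+: x.1 →
      x.1.length = v.1.length + n → (T.graph.induce W).Reachable ⟨v, hv⟩ ⟨x, hxW⟩ := by
    intro n
    induction n with
    | zero =>
      intro v hv hp hl
      have : v = x := Subtype.ext (hp.eq_of_length (by omega))
      subst this
      exact .refl _
    | succ n ih =>
      intro v hv hp hl
      obtain ⟨_ | ⟨d, z⟩, hz⟩ := hp
      · rw [← hz] at hl; simp at hl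
      have hdx : v.1 ++ [d] <+: x.1 := ⟨z, by rw [← hz]; simp⟩
      let u : T.Vertex := ⟨v.1 ++ [d], T.prefix_closed _ x.2 _ hdx⟩
      have hu : u ∈ W := by
        rcases hv with hv | ⟨y, hy, hxy⟩
        · rw [hv] at hl; omega
        refine .inr ⟨y, hy, ?_⟩
        rw [direction_append_singleton.2 hdx] at hxy
        have hny : ¬ u.1 <+: y.1 := fun h => hxy (direction_append_singleton.2 h).symm
        rw [direction_of_not_prefix hny, direction_of_prefix (show u.1 <+: x.1 from hdx)]
        exact Option.some_ne_none _
      have hadj : (T.graph.induce W).Adj ⟨v, hv⟩ ⟨u, hu⟩ := .inl ⟨d, rfl⟩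
      refine hadj.reachable.trans (ih u hu hdx ?_)
      rw [hl]; simp [u]; omega
  -- Elsewhere, climb to the predecessor: `v` has `y` below it but not `x`, so the two directions
  -- still differ one level up.
  have above : ∀ (n : ℕ) (v : T.Vertex) (hv : v ∈ W), v.1.length = n →
      (T.graph.induce W).Reachable ⟨v, hv⟩ ⟨x, hxW⟩ := by
    intro n
    induction n with
    | zero =>
      intro v hv hl
      refine below x.1.length v hv ?_ (by omega)
      rw [List.length_eq_zero_iff.1 hl]; exact List.nil_prefix
    | succ n ih =>
      intro v hv hl
      by_cases hp : v.1 <+: x.1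
      · exact below (x.1.length - v.1.length) v hv hp (by have := hp.length_le; omega)
      rcases hv with hv | ⟨y, hy, hxy⟩
      · exact (hp (hv ▸ List.prefix_rfl)).elim
      have hv' : v ∈ W := .inr ⟨y, hy, hxy⟩
      have hne : v.1 ≠ [] := by intro h; rw [h] at hl; simp at hl
      obtain ⟨s, d, hs⟩ := (List.eq_nil_or_concat v.1).resolve_left hne
      rw [List.concat_eq_append] at hs
      let u : T.Vertex := ⟨s, T.prefix_closed _ v.2 _ (hs ▸ List.prefix_append _ _)⟩
      have hvy : v.1 <+: y.1 := by
        by_contra h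
        exact hxy (by rw [direction_of_not_prefix h, direction_of_not_prefix hp])
      have hu : u ∈ W := by
        refine .inr ⟨y, hy, ?_⟩
        rw [hs] at hvy hp
        rw [show direction u.1 y.1 = _ from direction_append_singleton.2 hvy]
        exact fun h => hp (direction_append_singleton.1 h)
      have hadj : (T.graph.induce W).Adj ⟨v, hv'⟩ ⟨u, hu⟩ := .inr ⟨d, hs⟩
      refine hadj.reachable.trans (ih u hu ?_)
      rw [hs] at hl
      simpa [u] using hl
  have : Nonempty W := ⟨⟨x, hxW⟩⟩
  exact ⟨fun a b => (above _ a.1 a.2 rfl).trans (above _ b.1 b.2 rfl).symm⟩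

variable (L : FirstOrder.Language.{u, v}) (A : Type w') [L.Structure A]

/-- Place elements and tuples in a tree, and put every element into the bags on the paths to the
tuples containing it. -/
def TreeDecomposition.ofPlacement (h : Incidence L A → T.Vertex) : TreeDecomposition L A T where
  U v := {a | h (.inl a) = v ∨ ∃ y ∈ {y | ∃ c : Tuples L A, (∃ j, c.1.2 j = a) ∧ h (.inr c) = y},
    direction v.1 (h (.inl a)).1 ≠ direction v.1 y.1}
  connected a := connected_induce_between T _ _
  covers {l} R c hc := by
    let e : Tuples L A := ⟨⟨l, c⟩, R, hc⟩
    -- Seen from the vertex of the tuple, anything placed elsewhere lies in another direction than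
    -- that vertex itself.
    refine ⟨h (.inr e), fun j => ?_⟩
    by_cases hj : h (.inl (c j)) = h (.inr e)
    · exact .inl hj
    · exact .inr ⟨_, ⟨e, ⟨j, rfl⟩, rfl⟩, fun hd => hj (Subtype.ext (eq_of_direction_eq_self hd))⟩

end Placement

end MSO

namespace MSO

/-! ### Transductions producing incidence structures -/

/-- With `a` inside `S` and `c` outside, the inner part of the assignment is `![{a}, ∅]` and does
not involve `c`. -/
theorem realizeAt_of_row_eq {L : FirstOrder.Language.{u, v}} {M : Type w} [L.Structure M]
    {φ : Formula L 2} {S : Set M} {α : Type*} {t : (Fin 2 → Set M) → α}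
    (ht : ∀ V V', t V = t V' → ∀ Y : Fin 2 → Set M,
      φ.Realize (fun j => S.ite (V j) (Y j)) → φ.Realize fun j => S.ite (V' j) (Y j))
    {a a' c : M} (ha : a ∈ S) (ha' : a' ∈ S) (hc : c ∉ S)
    (h : t ![{a}, ∅] = t ![{a'}, ∅]) (hφ : φ.RealizeAt ![a, c]) : φ.RealizeAt ![a', c] := by
  have key : ∀ b ∈ S, (fun j => {(![b, c] : Fin 2 → M) j} : Fin 2 → Set M) =
      fun j => S.ite ((![{b}, ∅] : Fin 2 → Set M) j) ((![∅, {c}] : Fin 2 → Set M) j) := by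
    intro b hb
    funext j
    revert j
    refine Fin.forall_fin_two.2 ⟨?_, ?_⟩ <;> ext x <;> rw [mem_ite_iff]
    · change x = b ↔ (x ∈ S ∧ x = b) ∨ (x ∉ S ∧ False)
      exact ⟨fun h => .inl ⟨h ▸ hb, h⟩, by tauto⟩
    · change x = c ↔ (x ∈ S ∧ False) ∨ (x ∉ S ∧ x = c)
      exact ⟨fun h => .inr ⟨h ▸ hc, h⟩, by tauto⟩
  unfold Formula.RealizeAt at hφ ⊢
  rw [key a ha] at hφ
  rw [key a' ha']
  exact ht _ _ h _ hφ

/-- The possible positions in a tuple of a structure. -/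
abbrev Position (L : FirstOrder.Language.{u, v}) : Type :=
  {i : ℕ // ∃ l, i < l ∧ Nonempty (L.Relations l)}

theorem finite_position (L : FirstOrder.Language.{u, v}) [Finite L.Symbols] :
    Finite (Position L) := by
  have : Finite (Σ l, L.Relations l) :=
    Finite.of_injective (Sum.inr : _ → L.Symbols) Sum.inr_injective
  refine Finite.of_surjective
    (fun s : Σ R : (Σ l, L.Relations l), Fin R.1 => (⟨s.2.1, s.1.1, s.2.2, ⟨s.1.2⟩⟩ : Position L)) ?_
  rintro ⟨i, l, hi, ⟨R⟩⟩
  exact ⟨⟨⟨l, R⟩, ⟨i, hi⟩⟩, rfl⟩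

theorem relMap_inc_iff {L : FirstOrder.Language.{u, v}} {A : Type w} [L.Structure A]
    (i : Position L) (a : A) (c : Tuples L A) :
    Structure.RelMap (L := incidenceLanguage L) (M := Incidence L A) (IncidenceRel.inc i.1 i.2)
      ![Sum.inl a, Sum.inr c] ↔ ∃ h : i.1 < c.1.1, a = c.1.2 ⟨i.1, h⟩ := by
  constructor
  · rintro ⟨a', c', h1, h2, h3⟩
    cases Sum.inl_injective h1
    cases Sum.inr_injective h2
    exact h3
  · intro h
    exact ⟨a, c, rfl, rfl, h⟩

end MSO

theorem mainTheorem4 (m : ℕ) (L : FirstOrder.Language.{u, v}) [L.IsRelational] [Finite L.Symbols]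
    (τ : MSO.Transduction (MSO.treeLanguage m) (MSO.incidenceLanguage L)) :
    ∃ k : ℕ, ∀ (D : Type w) (T : MSO.ColouredTree D m)
      (A : Type w') [L.Structure A] [Finite A],
      τ.Produces T.Vertex (MSO.Incidence L A) →
        ∃ H : MSO.TreeDecomposition L A T, H.WidthLE k := by
  classical
  have := MSO.finite_position L
  choose α hα hrow using fun i : MSO.Position L =>
    MSO.finiteRows_cut.{w} (τ.basic.φ (MSO.IncidenceRel.inc i.1 i.2))
  -- The first summand counts copies of the vertex; the second is four times the number of pairs of
  -- a position and a row.
  refine ⟨τ.k + 4 * Nat.card (Σ i, α i), fun D T A _ _ ⟨Q, _, ⟨e⟩⟩ => ?_⟩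
  have hinc : ∀ (i : MSO.Position L) (a : A) (c : MSO.Tuples L A),
      (τ.basic.φ (MSO.IncidenceRel.inc i.1 i.2)).RealizeAt
        ![(e (Sum.inl a)).1, (e (Sum.inr c)).1] ↔ ∃ h : i.1 < c.1.1, a = c.1.2 ⟨i.1, h⟩ := by
    intro i a c
    refine Iff.trans ?_ ((e.map_rel (MSO.IncidenceRel.inc i.1 i.2 :
      (MSO.incidenceLanguage L).Relations 2) ![Sum.inl a, Sum.inr c]).trans
        (MSO.relMap_inc_iff i a c))
    have : (![(e (Sum.inl a)).1, (e (Sum.inr c)).1] :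
        Fin 2 → MSO.Copies τ.k (MSO.Expansion Q)) =
        fun j => ((e ∘ ![Sum.inl a, Sum.inr c]) j).1 := by
      funext j; fin_cases j <;> rfl
    rw [this]
    exact Iff.rfl
  let h : MSO.Incidence L A → T.Vertex := fun x => (e x).1.1
  refine ⟨MSO.TreeDecomposition.ofPlacement T L A h, fun v => ?_⟩
  have : Fintype A := Fintype.ofFinite A
  set Y : A → Set T.Vertex :=
    fun a => {y | ∃ c : MSO.Tuples L A, (∃ j, c.1.2 j = a) ∧ h (.inr c) = y} with hY
  let B : Finset A := Finset.univ.filter fun a =>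
    ∃ y ∈ Y a, MSO.direction v.1 (h (.inl a)).1 ≠ MSO.direction v.1 y.1
  have hU : (MSO.TreeDecomposition.ofPlacement T L A h).U v =
      {a | h (.inl a) = v} ∪ (B : Set A) := by
    ext a
    simp only [B, Set.mem_union, Finset.mem_coe, Finset.mem_filter, Finset.mem_univ, true_and]
    rfl
  have h1 : {a : A | h (.inl a) = v}.encard ≤ τ.k := by
    have := Set.encard_le_encard_of_injOn (s := {a : A | h (.inl a) = v})
      (t := (Set.univ : Set (Fin τ.k))) (f := fun a => (e (Sum.inl a)).1.2)
      (fun _ _ => Set.mem_univ _) (fun a ha b hb hab =>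
        Sum.inl_injective (e.injective (Subtype.ext (Prod.ext (ha.trans hb.symm) hab))))
    simpa using this
  have h2 : B.card ≤ 4 * Nat.card (Σ i, α i) := by
    have : Finite T.Vertex := T.finite_carrier
    -- Outside `B` the chosen vertex is the dummy `v`.
    have hyB : ∀ a, ∃ y, a ∈ B →
        y ∈ Y a ∧ MSO.direction v.1 (h (.inl a)).1 ≠ MSO.direction v.1 y.1 := fun a =>
      if ha : a ∈ B then (Finset.mem_filter.1 ha).2.imp fun _ hy _ => hy
      else ⟨v, fun h => (ha h).elim⟩
    choose y hyB using hyB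
    -- Only directions that occur are kept, so that averaging runs over subsets of a finite set even
    -- if `D` is infinite.
    let dir : T.Vertex → Set.range fun x : T.Vertex => MSO.direction v.1 x.1 :=
      fun x => ⟨_, x, rfl⟩
    refine MSO.card_le_of_separated B (fun a => dir (h (.inl a))) (fun a => dir (y a))
      (fun a ha hd => (hyB a ha).2 (congrArg Subtype.val hd)) _ fun C F hF => ?_
    let K : MSO.Cut.{w} m τ.p := ⟨D, T, Q, v, Subtype.val '' (↑C : Set (Set.range fun x : T.Vertex => MSO.direction v.1 x.1))⟩
    have hK : ∀ x, x ∈ K.side τ.k ↔ dir x.1 ∈ C := fun x =>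
      Subtype.val_injective.mem_set_image (s := (↑C : Set (Set.range fun x : T.Vertex => MSO.direction v.1 x.1))) (a := dir x.1)
    choose t ht using fun i => hrow i K
    have hex : ∀ a : F,
        ∃ (i : MSO.Position L) (c : MSO.Tuples L A), (∃ h : i.1 < c.1.1, a.1 = c.1.2 ⟨i.1, h⟩) ∧
          (e (Sum.inl a.1)).1 ∈ K.side τ.k ∧ (e (Sum.inr c)).1 ∉ K.side τ.k := by
      rintro ⟨a, ha⟩
      obtain ⟨haB, haC, hyC⟩ := hF a ha
      obtain ⟨c, ⟨j, hj⟩, hc⟩ := (hyB a haB).1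
      obtain ⟨R, _⟩ := c.2
      refine ⟨⟨j.1, _, j.2, ⟨R⟩⟩, c, ⟨j.2, hj.symm⟩, (hK _).2 haC, fun hm => hyC ?_⟩
      rw [← hc]
      exact (hK _).1 hm
    choose i c hic ha hc using hex
    rw [← Fintype.card_coe, ← Nat.card_eq_fintype_card]
    refine Nat.card_le_card_of_injective
      (fun a => (⟨i a, t (i a) ![{(e (Sum.inl a.1)).1}, ∅]⟩ : Σ i, α i)) fun a b hab => ?_
    obtain ⟨hi, hab⟩ := Sigma.mk.inj_iff.1 hab
    have hbt := hinc (i a) b.1 (c a)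
    rw [← hi] at hab
    obtain ⟨_, ha'⟩ := hic a
    -- Equal rows let `b` replace `a` against the tuple `c a`, so both are its component at position
    -- `i a`.
    obtain ⟨_, hb'⟩ := hbt.1 (MSO.realizeAt_of_row_eq (ht (i a)) (ha a) (ha b) (hc a)
      (eq_of_heq hab) ((hinc (i a) a.1 (c a)).2 (hic a)))
    exact Subtype.ext (ha'.trans hb'.symm)
  rw [hU]
  refine (Set.encard_union_le _ _).trans ?_
  rw [Set.encard_coe_eq_coe_finsetCard]
  refine (add_le_add h1 (Nat.cast_le.2 h2)).trans ?_
  push_cast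
  exact le_self_add
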